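/- Let $F$ be a finite forest with maximum degree $\Delta\ge 3$ and let $m\in\mathbb{N}$ (including $m=0$). The $m$-th power $F^m$ is the graph on the vertex set of $F$ in which two vertices $v,w$ are adjacent if and only if $1\le \operatorname{dist}_F(v,w)\le m$. The marking game on a finite graph $G=(V,E)$ is played by Alice and Bob, who alternately mark one unmarked vertex, Alice beginning, until every vertex is marked. The order of marking is a linear ordering $\le$ of $V$, whose score is $1+\max_{v\in V}|\{w\in V : vw\in E,\ w\le v\}|$. Alice wants to minimize the score and Bob wants to maximize it; the game colouring number $\mathrm{col}_g(G)$ is the score when both players play optimally. Then $$\mathrm{col}_g(F^m)\le \frac{(\Delta-1)^m-1}{\Delta-2}+2^m+1 .$$ -/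

import Mathlib

/-- The `m`-th power of a graph: distinct vertices are adjacent iff their distance
(which is `⊤` between different components) is between `1` and `m`. -/
def graphPower {V : Type*} (G : SimpleGraph V) (m : ℕ) : SimpleGraph V where
  Adj v w := 1 ≤ G.edist v w ∧ G.edist v w ≤ (m : ℕ∞)
  symm := ⟨fun v w h => by rwa [SimpleGraph.edist_comm] at h⟩
  loopless := ⟨fun v h => by simp at h⟩

namespace MarkingGame

open Classical in
/-- The back degree of `v` with respect to the linear ordering of the vertices given by the
list `l` of all vertices in the order in which they were marked: the number of neighbours
of `v` that were marked before `v`. -/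
noncomputable def backDegree {V : Type*} [Fintype V] [DecidableEq V]
    (G : SimpleGraph V) (l : List V) (v : V) : ℕ :=
  (Finset.univ.filter fun w => G.Adj v w ∧ l.idxOf w ≤ l.idxOf v).card

/-- The score of a finished play: one plus the maximum back degree. -/
noncomputable def score {V : Type*} [Fintype V] [DecidableEq V]
    (G : SimpleGraph V) (l : List V) : ℕ :=
  1 + Finset.univ.sup (backDegree G l)

/-- The vertices that are still unmarked after the moves `l`. -/
def unmarked {V : Type*} [Fintype V] [DecidableEq V] (l : List V) : Finset V :=
  Finset.univ.filter fun v => v ∉ l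

theorem card_unmarked_append_lt {V : Type*} [Fintype V] [DecidableEq V]
    (l : List V) (v : V) (hv : v ∈ unmarked l) :
    (unmarked (l ++ [v])).card < (unmarked l).card := by
  apply Finset.card_lt_card
  rw [Finset.ssubset_iff_of_subset]
  · exact ⟨v, hv, by simp [unmarked]⟩
  · intro w hw
    simp only [unmarked, Finset.mem_filter, Finset.mem_univ, true_and, List.mem_append,
      not_or] at hw ⊢
    exact hw.1

/-- The final score of the marking game on `G` under optimal play by both players from the
position in which the vertices of `l` have been marked, in this order. Alice moves first, so
she is to move iff an even number of vertices is marked; she minimizes the score and Bob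
maximizes it. A player has to mark exactly one unmarked vertex in each move, and the game ends
when all vertices are marked. -/
noncomputable def value {V : Type*} [Fintype V] [DecidableEq V]
    (G : SimpleGraph V) (l : List V) : ℕ :=
  if h : (unmarked l).Nonempty then
    if Even l.length then
      (unmarked l).attach.inf' h.attach fun v => value G (l ++ [v.1])
    else
      (unmarked l).attach.sup' h.attach fun v => value G (l ++ [v.1])
  else score G l
termination_by (unmarked l).card
decreasing_by
  · exact card_unmarked_append_lt l v.1 v.2
  · exact card_unmarked_append_lt l v.1 v.2

end MarkingGame

/-- The game colouring number of a finite graph: the score of the marking game, begun with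
all vertices unmarked, when both players play optimally. -/
noncomputable def gameColouringNumber {V : Type*} [Fintype V] [DecidableEq V]
    (G : SimpleGraph V) : ℕ :=
  MarkingGame.value G []

open Finset

/-! Root each component. After each of her moves Alice wants weights `t` balanced at every vertex.
Balance makes the marked vertices in the top `k` levels below `u` number at most `t u * (2 ^ k - 1)`
(`card_branch_inter_le`). The children of an unmarked vertex have total weight at most 1, so it sees
at most `2 ^ m - 1` marked vertices below it. Through its parent it sees at most the geometric sum,
and Bob's last mark adds at most one. To restore balance after Bob marks `x`, raise the weights of
`x` and of its ancestors in turn. The climb stops at a root, or at an unmarked vertex whose children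
reach weight 2, and Alice marks that vertex (`balanced_or_exists_insert`). -/

/-! ### Rooting a forest -/

/-- `d` is a height function that orients the graph as a rooted forest: the ends of an edge have
different heights, and every vertex has at most one neighbour of smaller height. -/
structure IsRooting {V : Type*} (F : SimpleGraph V) (d : V → ℕ) : Prop where
  ne : ∀ ⦃u v⦄, F.Adj u v → d u ≠ d v
  eq : ∀ ⦃u v w⦄, F.Adj u v → F.Adj u w → d v < d u → d w < d u → v = w

/-- The height is the distance to a chosen representative of the component. -/
theorem SimpleGraph.IsAcyclic.exists_isRooting {V : Type*} {F : SimpleGraph V}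
    (hF : F.IsAcyclic) : ∃ d : V → ℕ, IsRooting F d := by
  classical
  let r : V → V := fun v => (F.connectedComponentMk v).out
  have hr : ∀ v, F.Reachable (r v) v := fun v =>
    SimpleGraph.ConnectedComponent.exact (Quot.out_eq (F.connectedComponentMk v))
  have hadj : ∀ {u v}, F.Adj u v → r u = r v := fun {u v} h => by
    simp only [r, SimpleGraph.ConnectedComponent.sound h.reachable]
  have key : ∀ {u v} (p : F.Walk (r u) u), p.IsPath → p.length = F.dist (r u) u →
      F.Adj u v → F.dist (r v) v < F.dist (r u) u → v = p.penultimate := by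
    intro u v p hp hpl h hlt
    refine hF.eq_penultimate_of_adj_end hp h ?_
    obtain ⟨q, hq, hql⟩ := (hr v).exists_path_of_dist
    have hrv := hadj h
    -- A geodesic to `v` is too short to pass through `u`, so in a forest `v` lies on the path to
    -- `u`.
    have hu : u ∉ (q.copy hrv.symm rfl).support := by
      intro hu
      have h1 := SimpleGraph.dist_le ((q.copy hrv.symm rfl).takeUntil u hu)
      have h2 := (q.copy hrv.symm rfl).length_takeUntil_le_length hu
      simp only [SimpleGraph.Walk.length_copy] at h2
      omega
    have hq' : (q.copy hrv.symm rfl).IsPath := by simpa using hq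
    exact hF.mem_support_of_ne_mem_support_of_adj_of_isPath hp hq' h hu
  refine ⟨fun v => F.dist (r v) v, ?_, ?_⟩
  · intro u v h
    have := hF.dist_ne_of_adj h (hr u)
    rwa [← hadj h]
  · intro u v w hv hw hdv hdw
    obtain ⟨p, hp, hpl⟩ := (hr u).exists_path_of_dist
    exact (key p hp hpl hv hdv).trans (key p hp hpl hw hdw).symm

/-! ### Balanced weights and Alice's reply -/

/-- Raise the weight of `y` by one. -/
def raise {V : Type*} [DecidableEq V] (t : V → ℕ) (y : V) : V → ℕ := Function.update t y (t y + 1)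

theorem raise_self {V : Type*} [DecidableEq V] (t : V → ℕ) (y : V) : raise t y y = t y + 1 := by simp [raise]

theorem raise_of_ne {V : Type*} [DecidableEq V] (t : V → ℕ) {y u : V} (h : u ≠ y) : raise t y u = t u := by
  simp [raise, h]

section Rooted

variable {V : Type*} [Fintype V] {F : SimpleGraph V} {d : V → ℕ}

open Classical in
/-- The children of `u`: its neighbours of larger height. -/
noncomputable def children (F : SimpleGraph V) (d : V → ℕ) (u : V) : Finset V :=
  univ.filter fun w => F.Adj u w ∧ d u < d w

theorem mem_children {u w : V} : w ∈ children F d u ↔ F.Adj u w ∧ d u < d w := by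
  simp [children]

theorem notMem_children_self (y : V) : y ∉ children F d y := by
  simp [mem_children]

/-- The total weight of the children of `u`. -/
noncomputable def childWeight (F : SimpleGraph V) (d t : V → ℕ) (u : V) : ℕ :=
  ∑ c ∈ children F d u, t c

/-- The condition on the weights `t` at the vertex `u` which Alice maintains, where `M` is the
set of marked vertices. -/
def BalancedAt (F : SimpleGraph V) (d : V → ℕ) (M : Finset V) (t : V → ℕ) (u : V) : Prop :=
  (u ∈ M → 1 ≤ t u ∧ childWeight F d t u ≤ t u + 1) ∧
    (u ∉ M → childWeight F d t u ≤ t u ∧ childWeight F d t u ≤ 1)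

/-- The condition at `u` after the weight of one child of `u` has been raised by one. -/
def NearlyBalancedAt (F : SimpleGraph V) (d : V → ℕ) (M : Finset V) (t : V → ℕ) (u : V) : Prop :=
  (u ∈ M → 1 ≤ t u ∧ childWeight F d t u ≤ t u + 2) ∧
    (u ∉ M → childWeight F d t u ≤ t u + 1 ∧ childWeight F d t u ≤ 2)

/-- Some weights are balanced at every vertex. -/
def BalancedMarking (F : SimpleGraph V) (d : V → ℕ) (M : Finset V) : Prop :=
  ∃ t, ∀ u, BalancedAt F d M t u

theorem balancedMarking_empty : BalancedMarking F d (∅ : Finset V) :=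
  ⟨fun _ => 0, fun u => by simp [BalancedAt, childWeight]⟩

variable [DecidableEq V]

theorem childWeight_raise_of_notMem (t : V → ℕ) {y u : V} (h : y ∉ children F d u) :
    childWeight F d (raise t y) u = childWeight F d t u :=
  sum_congr rfl fun c hc => raise_of_ne t (by rintro rfl; exact h hc)

theorem childWeight_raise_of_mem (t : V → ℕ) {y u : V} (h : y ∈ children F d u) :
    childWeight F d (raise t y) u = childWeight F d t u + 1 := by
  unfold childWeight
  rw [← add_sum_erase _ _ h, ← add_sum_erase _ _ h, raise_self,
    sum_congr rfl fun c hc => raise_of_ne t (ne_of_mem_erase hc)]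
  omega

theorem childWeight_raise_self (t : V → ℕ) (y : V) :
    childWeight F d (raise t y) y = childWeight F d t y :=
  childWeight_raise_of_notMem t (notMem_children_self y)

/-- Raising the weight of `y` can only disturb the balance at the parent of `y`. -/
theorem balanced_or_exists_parent (hd : IsRooting F d) {M : Finset V} {t : V → ℕ} {y : V}
    (ht : ∀ u ≠ y, BalancedAt F d M t u) (hy : BalancedAt F d M (raise t y) y) :
    BalancedMarking F d M ∨ ∃ z, d z < d y ∧ NearlyBalancedAt F d M (raise t y) z ∧
      ∀ u ≠ z, BalancedAt F d M (raise t y) u := by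
  have other : ∀ u, y ∉ children F d u → BalancedAt F d M (raise t y) u := by
    intro u hu
    by_cases huy : u = y
    · exact huy ▸ hy
    · have := ht u huy
      unfold BalancedAt at this ⊢
      rwa [childWeight_raise_of_notMem t hu, raise_of_ne t huy]
  by_cases h : ∃ z, y ∈ children F d z
  · obtain ⟨z, hz⟩ := h
    have hz' := mem_children.1 hz
    refine Or.inr ⟨z, hz'.2, ?_, fun u hu => other u fun hyu => hu ?_⟩
    · have hzy : z ≠ y := hz'.1.ne
      have := ht z hzy
      unfold BalancedAt at this
      unfold NearlyBalancedAt
      rw [childWeight_raise_of_mem t hz, raise_of_ne t hzy]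
      exact ⟨fun h => ⟨(this.1 h).1, by have := this.1 h; omega⟩,
        fun h => by have := this.2 h; omega⟩
    · have hu' := mem_children.1 hyu
      exact hd.eq hu'.1.symm hz'.1.symm hu'.2 hz'.2
  · exact Or.inl ⟨_, fun u => other u fun hu => h ⟨u, hu⟩⟩

/-- The climb towards the root: raising `t y` repairs `y` and passes the defect to its parent. It
terminates because heights decrease. -/
theorem balanced_or_exists_insert (hd : IsRooting F d) {M : Finset V} {t : V → ℕ} {y : V}
    (ht : ∀ u ≠ y, BalancedAt F d M t u) (hy : NearlyBalancedAt F d M t y) :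
    BalancedMarking F d M ∨ ∃ z ∉ M, d z ≤ d y ∧ BalancedMarking F d (insert z M) := by
  induction hn : d y using Nat.strong_induction_on generalizing y t with
  | _ n ih =>
    subst hn
    have step (h : BalancedAt F d M (raise t y) y) :
        BalancedMarking F d M ∨ ∃ z ∉ M, d z ≤ d y ∧ BalancedMarking F d (insert z M) := by
      rcases balanced_or_exists_parent hd ht h with h | ⟨z, hz, hz1, hz2⟩
      · exact Or.inl h
      · rcases ih _ hz hz2 hz1 rfl with h | ⟨x, hx, hxz, h⟩
        · exact Or.inl h
        · exact Or.inr ⟨x, hx, hxz.trans hz.le, h⟩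
    by_cases hyM : y ∈ M
    · refine step ⟨fun _ => ?_, fun h => absurd hyM h⟩
      rw [childWeight_raise_self, raise_self]
      have := hy.1 hyM
      omega
    · have hy2 := hy.2 hyM
      by_cases h2 : childWeight F d t y ≤ 1
      · refine step ⟨fun h => absurd h hyM, fun _ => ?_⟩
        rw [childWeight_raise_self, raise_self]
        omega
      -- The child weight is now exactly 2, which forces `1 ≤ t y`; marking `y` balances it with `t`
      -- unchanged.
      · refine Or.inr ⟨y, hyM, le_rfl, t, fun u => ?_⟩
        by_cases huy : u = y
        · subst huy
          exact ⟨fun _ => by omega, fun h => absurd (mem_insert_self _ _) h⟩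
        · simpa [BalancedAt, huy] using ht u huy

/-- After a vertex has been marked in a balanced position, the position is balanced or can be
balanced by marking a further vertex. -/
theorem BalancedMarking.insert (hd : IsRooting F d) {M : Finset V} (hM : BalancedMarking F d M) {x : V}
    (hx : x ∉ M) : BalancedMarking F d (insert x M) ∨
      ∃ z ∉ insert x M, d z < d x ∧ BalancedMarking F d (insert z (insert x M)) := by
  obtain ⟨t, ht⟩ := hM
  have h1 : ∀ u ≠ x, BalancedAt F d (Insert.insert x M) t u := fun u hu => by
    simpa [BalancedAt, hu] using ht u
  have h2 : BalancedAt F d (Insert.insert x M) (raise t x) x := by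
    refine ⟨fun _ => ?_, fun h => absurd (mem_insert_self _ _) h⟩
    rw [childWeight_raise_self, raise_self]
    have := (ht x).2 hx
    omega
  rcases balanced_or_exists_parent hd h1 h2 with h | ⟨z, hz, hz1, hz2⟩
  · exact Or.inl h
  · rcases balanced_or_exists_insert hd hz2 hz1 with h | ⟨y, hy, hyz, h⟩
    · exact Or.inl h
    · exact Or.inr ⟨y, hy, hyz.trans_lt hz, h⟩

/-- An unmarked vertex of least height is a free move: the climb from it could only stop at a lower
unmarked vertex. -/
theorem BalancedMarking.exists_insert (hd : IsRooting F d) {M : Finset V} (hM : BalancedMarking F d M)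
    (hne : ∃ v, v ∉ M) : ∃ v ∉ M, BalancedMarking F d (Insert.insert v M) := by
  obtain ⟨v, hv, hmin⟩ := exists_min_image (univ.filter (· ∉ M)) d (by simpa [filter_nonempty_iff])
  simp only [mem_filter, mem_univ, true_and] at hv hmin
  refine ⟨v, hv, (hM.insert hd hv).resolve_right ?_⟩
  rintro ⟨z, hz, hlt, -⟩
  exact (hmin z fun h => hz (mem_insert_of_mem h)).not_gt hlt

/-! ### Counting marked vertices in branches -/

/-- The vertices reached from `u` by walks on fewer than `k` edges that first avoid `v` and never
turn back. -/
def branch (F : SimpleGraph V) [DecidableRel F.Adj] : ℕ → V → V → Finset V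
  | 0, _, _ => ∅
  | k + 1, u, v => insert u (((F.neighborFinset u).erase v).biUnion fun w => branch F k w u)

theorem card_branch_le [DecidableRel F.Adj] {Δ : ℕ} (hΔ : F.maxDegree ≤ Δ) (k : ℕ) {u v : V}
    (h : F.Adj u v) : (branch F k u v).card ≤ ∑ i ∈ range k, (Δ - 1) ^ i := by
  induction k generalizing u v with
  | zero => simp [branch]
  | succ k ih =>
    rw [branch, sum_range_succ', pow_zero]
    refine (card_insert_le _ _).trans (Nat.succ_le_succ ?_)
    refine (card_biUnion_le_card_mul _ _ (∑ i ∈ range k, (Δ - 1) ^ i) fun w hw => ih ?_).trans ?_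
    · exact ((F.mem_neighborFinset u w).1 (mem_of_mem_erase hw)).symm
    · rw [card_erase_of_mem ((F.mem_neighborFinset u v).2 h), F.card_neighborFinset_eq_degree]
      simp only [pow_succ, ← sum_mul]
      rw [mul_comm]
      gcongr
      exact (F.degree_le_maxDegree u).trans hΔ

theorem card_branch_inter_le [DecidableRel F.Adj] (hd : IsRooting F d) {M : Finset V}
    {t : V → ℕ} (ht : ∀ u, BalancedAt F d M t u) (k : ℕ) {u v : V} (h : F.Adj v u)
    (hlt : d v < d u) : (branch F k u v ∩ M).card ≤ t u * (2 ^ k - 1) := by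
  induction k generalizing u v with
  | zero => simp [branch]
  | succ k ih =>
    have hsub : (F.neighborFinset u).erase v ⊆ children F d u := by
      intro w hw
      have hw' := mem_erase.1 hw
      have hadj := (F.mem_neighborFinset u w).1 hw'.2
      refine mem_children.2 ⟨hadj, lt_of_le_of_ne (not_lt.1 fun hwu => hw'.1 ?_) (hd.ne hadj)⟩
      exact hd.eq hadj h.symm hwu hlt
    have hsum : ((((F.neighborFinset u).erase v).biUnion fun w => branch F k w u) ∩ M).card
        ≤ childWeight F d t u * (2 ^ k - 1) := by
      rw [biUnion_inter, childWeight, sum_mul]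
      refine card_biUnion_le.trans ((sum_le_sum_of_subset hsub).trans (sum_le_sum fun c hc => ?_))
      have hc' := mem_children.1 hc
      exact ih hc'.1 hc'.2
    obtain ⟨a, ha⟩ : ∃ a, 2 ^ k = a + 1 := ⟨2 ^ k - 1, by have := Nat.one_le_two_pow (n := k); omega⟩
    have ha' : 2 ^ (k + 1) - 1 = 2 * a + 1 := by rw [pow_succ, ha]; omega
    rw [ha, Nat.add_sub_cancel] at hsum
    rw [ha', branch]
    by_cases hu : u ∈ M
    · obtain ⟨h1, h2⟩ := (ht u).1 hu
      rw [insert_inter_of_mem hu]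
      refine (card_insert_le _ _).trans ?_
      -- With `a = 2 ^ k - 1`: `1 + (t u + 1) * a ≤ t u * (2 * a + 1)`, since `1 ≤ t u`.
      nlinarith [Nat.mul_le_mul_right a h2, Nat.mul_le_mul_right a h1]
    · have h1 := ((ht u).2 hu).1
      rw [insert_inter_of_notMem hu]
      nlinarith [Nat.mul_le_mul_right a h1]

theorem SimpleGraph.Walk.IsPath.mem_branch [DecidableRel F.Adj] {v u w : V} (h : F.Adj v u)
    {p : F.Walk u w} (hp : p.IsPath) (hv : v ∉ p.support) {k : ℕ} (hk : p.length < k) :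
    w ∈ branch F k u v := by
  induction p generalizing v k with
  | nil =>
    obtain ⟨k, rfl⟩ := Nat.exists_eq_succ_of_ne_zero hk.ne_bot
    exact mem_insert_self _ _
  | @cons a b c hab q ih =>
    obtain ⟨k, rfl⟩ := Nat.exists_eq_succ_of_ne_zero (Nat.ne_zero_of_lt hk)
    rw [SimpleGraph.Walk.cons_isPath_iff] at hp
    rw [SimpleGraph.Walk.support_cons, List.mem_cons, not_or] at hv
    refine mem_insert_of_mem (mem_biUnion.2 ⟨b, mem_erase.2 ⟨?_, ?_⟩, ih hab hp.1 hp.2 ?_⟩)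
    · rintro rfl
      exact hv.2 q.start_mem_support
    · exact (F.mem_neighborFinset a b).2 hab
    · simpa using hk

theorem exists_mem_branch_of_graphPower_adj [DecidableRel F.Adj] {m : ℕ} {v w : V}
    (h : (graphPower F m).Adj v w) : ∃ u, F.Adj v u ∧ w ∈ branch F m u v := by
  have hne : F.edist v w ≠ ⊤ := ne_top_of_le_ne_top (ENat.natCast_ne_top m) h.2
  have hr := SimpleGraph.reachable_of_edist_ne_top hne
  obtain ⟨p, hp, hpl⟩ := hr.exists_path_of_dist
  have hm : p.length ≤ m := by
    have := h.2
    rw [← hr.coe_dist_eq_edist] at this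
    rw [hpl]
    exact_mod_cast this
  cases p with
  | nil => exact absurd h ((graphPower F m).loopless.irrefl _)
  | @cons _ u _ hvu q =>
    rw [SimpleGraph.Walk.cons_isPath_iff] at hp
    exact ⟨u, hvu, hp.1.mem_branch hvu hp.2 (by simpa using hm)⟩

open Classical in
/-- In a balanced position an unmarked vertex has few marked neighbours in the power. -/
theorem BalancedMarking.card_filter_adj_lt [DecidableRel F.Adj] (hd : IsRooting F d) {M : Finset V}
    (hM : BalancedMarking F d M) {Δ : ℕ} (hΔ : F.maxDegree ≤ Δ) (m : ℕ) {v : V} (hv : v ∉ M) :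
    (M.filter ((graphPower F m).Adj v)).card < ∑ i ∈ range m, (Δ - 1) ^ i + 2 ^ m := by
  obtain ⟨t, ht⟩ := hM
  have hdown : ((children F d v).biUnion fun u => branch F m u v ∩ M).card ≤ 2 ^ m - 1 := by
    refine card_biUnion_le.trans ((sum_le_sum (g := fun u => t u * (2 ^ m - 1)) fun u hu => ?_).trans ?_)
    · have hu' := mem_children.1 hu
      exact card_branch_inter_le hd ht m hu'.1 hu'.2
    · rw [← sum_mul]
      exact (Nat.mul_le_mul_right _ ((ht v).2 hv).2).trans_eq (one_mul _)
  have hcover : ∀ w ∈ M.filter ((graphPower F m).Adj v),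
      w ∈ ((children F d v).biUnion fun u => branch F m u v ∩ M) ∨
        ∃ u, F.Adj v u ∧ d u < d v ∧ w ∈ branch F m u v := by
    intro w hw
    rw [mem_filter] at hw
    obtain ⟨u, hvu, hwu⟩ := exists_mem_branch_of_graphPower_adj hw.2
    rcases lt_or_gt_of_ne (hd.ne hvu) with h | h
    · exact Or.inl (mem_biUnion.2 ⟨u, mem_children.2 ⟨hvu, h⟩, mem_inter.2 ⟨hwu, hw.1⟩⟩)
    · exact Or.inr ⟨u, hvu, h, hwu⟩
  have hpos := Nat.one_le_two_pow (n := m)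
  -- Towards the parent, all vertices of the branch are counted, marked or not.
  by_cases hp : ∃ p, F.Adj v p ∧ d p < d v
  · obtain ⟨p, hvp, hlt⟩ := hp
    have hsub : M.filter ((graphPower F m).Adj v) ⊆ branch F m p v ∪
        ((children F d v).biUnion fun u => branch F m u v ∩ M) := by
      intro w hw
      rcases hcover w hw with h | ⟨u, hvu, hu, hwu⟩
      · exact mem_union_right _ h
      · exact mem_union_left _ (hd.eq hvu hvp hu hlt ▸ hwu)
    have h1 := (card_le_card hsub).trans (card_union_le _ _)
    have h2 := card_branch_le hΔ m hvp.symm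
    omega
  · have hsub : M.filter ((graphPower F m).Adj v) ⊆
        ((children F d v).biUnion fun u => branch F m u v ∩ M) := by
      intro w hw
      rcases hcover w hw with h | ⟨u, hvu, hu, -⟩
      · exact h
      · exact absurd ⟨u, hvu, hu⟩ hp
    have h1 := card_le_card hsub
    omega

end Rooted

/-! ### From invariants to the value of the game -/

namespace MarkingGame

variable {V : Type*} [Fintype V] [DecidableEq V] {G : SimpleGraph V}

theorem backDegree_append_of_mem {l : List V} {v : V} (hv : v ∈ l) (x : V) :
    backDegree G (l ++ [x]) v = backDegree G l v := by
  unfold backDegree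
  congr 1
  ext w
  have hlt := List.idxOf_lt_length_of_mem hv
  simp only [mem_filter, mem_univ, true_and, List.idxOf_append_of_mem hv]
  by_cases hw : w ∈ l
  · rw [List.idxOf_append_of_mem hw]
  -- An absent vertex has index `l.length`, so it never counts as earlier than `v`.
  · rw [List.idxOf_append_of_notMem hw, List.idxOf_of_notMem hw]
    omega

open Classical in
theorem backDegree_append_self {l : List V} {x : V} (hx : x ∉ l) :
    backDegree G (l ++ [x]) x = (l.toFinset.filter (G.Adj x)).card := by
  unfold backDegree
  congr 1
  ext w
  simp only [mem_filter, mem_univ, true_and, List.mem_toFinset, List.idxOf_append_of_notMem hx]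
  rw [and_comm]
  refine and_congr_left fun hadj => ?_
  by_cases hw : w ∈ l
  · have := List.idxOf_lt_length_of_mem hw
    simp only [List.idxOf_append_of_mem hw, hw, iff_true]
    omega
  · simp [List.idxOf_append_of_notMem hw, hw, hadj.ne]

theorem mem_unmarked {l : List V} {v : V} : v ∈ unmarked l ↔ v ∉ l := by simp [unmarked]

open Classical in
/-- If Alice can maintain an invariant `A` of the positions in which she is to move and an
invariant `B` of the positions in which Bob is to move such that every marked vertex has back
degree at most `K`, then the game colouring number is at most `1 + K`. -/
theorem gameColouringNumber_le_of_invariants (K : ℕ) (A B : Finset V → Prop) (hempty : A ∅)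
    (hA : ∀ M, A M → (∃ v, v ∉ M) →
      ∃ v ∉ M, (M.filter (G.Adj v)).card ≤ K ∧ B (insert v M))
    (hB : ∀ M, B M → ∀ v ∉ M, (M.filter (G.Adj v)).card ≤ K ∧ A (insert v M)) :
    gameColouringNumber G ≤ 1 + K := by
  have main : ∀ n, ∀ l : List V, (unmarked l).card = n → (∀ v ∈ l, backDegree G l v ≤ K) →
      (Even l.length → A l.toFinset) → (¬ Even l.length → B l.toFinset) →
      value G l ≤ 1 + K := by
    intro n
    induction n using Nat.strong_induction_on with
    | _ n ih =>
      intro l hn hl hlA hlB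
      have hins : ∀ v, (l ++ [v]).toFinset = insert v l.toFinset := by
        intro v
        ext w
        simp
      have hback : ∀ v ∉ l, (l.toFinset.filter (G.Adj v)).card ≤ K →
          ∀ w ∈ l ++ [v], backDegree G (l ++ [v]) w ≤ K := by
        intro v hv hK w hw
        by_cases hwl : w ∈ l
        · exact (backDegree_append_of_mem hwl v).trans_le (hl w hwl)
        · obtain rfl : w = v := by simpa [hwl] using hw
          exact (backDegree_append_self hv).trans_le hK
      rw [value]
      split_ifs with h he
      · obtain ⟨x, hx⟩ := h
        obtain ⟨v, hv, hK, hBv⟩ := hA _ (hlA he) ⟨x, by simpa using mem_unmarked.1 hx⟩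
        rw [List.mem_toFinset] at hv
        have hv' := mem_unmarked.2 hv
        refine (inf'_le _ (mem_attach _ ⟨v, hv'⟩)).trans ?_
        refine ih _ (hn ▸ card_unmarked_append_lt l v hv') _ rfl (hback v hv hK) ?_ ?_
        · intro h
          simp [Nat.even_add_one, he] at h
        · intro _
          rwa [hins]
      · refine sup'_le _ _ fun ⟨v, hv'⟩ _ => ?_
        have hv := mem_unmarked.1 hv'
        obtain ⟨hK, hAv⟩ := hB _ (hlB he) v (by simpa using hv)
        refine ih _ (hn ▸ card_unmarked_append_lt l v hv') _ rfl (hback v hv hK) ?_ ?_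
        · intro _
          rwa [hins]
        · intro h
          simp [Nat.even_add_one, he] at h
      · refine Nat.add_le_add_left (Finset.sup_le fun v _ => hl v ?_) 1
        by_contra hv
        exact h ⟨v, mem_unmarked.2 hv⟩
  exact main _ [] rfl (by simp) (fun _ => by simpa using hempty) (fun h => by simp at h)

end MarkingGame

/-! ### The bound for forest powers -/

theorem gameColouringNumber_graphPower_le {V : Type*} [Fintype V] [DecidableEq V]
    {F : SimpleGraph V} [DecidableRel F.Adj] (hF : F.IsAcyclic) {Δ : ℕ} (hΔ : F.maxDegree ≤ Δ)
    (m : ℕ) :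
    gameColouringNumber (graphPower F m) ≤ 1 + (∑ i ∈ range m, (Δ - 1) ^ i + 2 ^ m) := by
  classical
  obtain ⟨d, hd⟩ := hF.exists_isRooting
  refine MarkingGame.gameColouringNumber_le_of_invariants _
    (fun M => BalancedMarking F d M ∨ ∃ N, ∃ x ∉ N, BalancedMarking F d N ∧ M = insert x N)
    (BalancedMarking F d) (Or.inl balancedMarking_empty) ?_ ?_
  · rintro M hM hne
    have hcard : ∀ v ∉ M, (M.filter ((graphPower F m).Adj v)).card ≤
        ∑ i ∈ range m, (Δ - 1) ^ i + 2 ^ m := by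
      intro v hv
      rcases hM with hM | ⟨N, x, -, hN, rfl⟩
      · exact (hM.card_filter_adj_lt hd hΔ m hv).le
      · rw [mem_insert, not_or] at hv
        have h := hN.card_filter_adj_lt hd hΔ m hv.2
        rw [filter_insert]
        split_ifs
        -- The strict bound before Bob's move leaves room for his vertex `x`.
        · exact (card_insert_le _ _).trans h
        · exact h.le
    have hmove : ∃ v ∉ M, BalancedMarking F d (insert v M) := by
      rcases hM with hM | ⟨N, x, hx, hN, rfl⟩
      · exact hM.exists_insert hd hne
      · rcases hN.insert hd hx with h | ⟨z, hz, -, h⟩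
        · exact h.exists_insert hd hne
        · exact ⟨z, hz, h⟩
    obtain ⟨v, hv, h⟩ := hmove
    exact ⟨v, hv, hcard v hv, h⟩
  · intro M hM v hv
    exact ⟨(hM.card_filter_adj_lt hd hΔ m hv).le, Or.inr ⟨M, v, hv, hM, rfl⟩⟩

theorem theorem2 {V : Type*} [Fintype V] [DecidableEq V]
    (F : SimpleGraph V) [DecidableRel F.Adj] (hF : F.IsAcyclic)
    (Δ : ℕ) (hmax : F.maxDegree = Δ) (hΔ : 3 ≤ Δ) (m : ℕ) :
    (gameColouringNumber (graphPower F m) : ℝ) ≤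
      (((Δ : ℝ) - 1) ^ m - 1) / ((Δ : ℝ) - 2) + 2 ^ m + 1 := by
  have h := gameColouringNumber_graphPower_le hF hmax.le m
  have hΔ' : (3 : ℝ) ≤ Δ := by exact_mod_cast hΔ
  have hgeom := geom_sum_eq (x := (Δ : ℝ) - 1) (by linarith) m
  rw [show (Δ : ℝ) - 1 - 1 = Δ - 2 by ring] at hgeom
  rw [← hgeom]
  have h' : (gameColouringNumber (graphPower F m) : ℝ) ≤
      ((1 + (∑ i ∈ range m, (Δ - 1) ^ i + 2 ^ m) : ℕ) : ℝ) := by exact_mod_cast h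
  push_cast [Nat.cast_sub (show 1 ≤ Δ by omega)] at h'
  linarith
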